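/- Let $M\ge 2$, let $\epsilon=(\epsilon_1,\dots,\epsilon_M)\in\mathbb{R}^M$ with $\epsilon_m>0$ for all $m$, and let $\tilde\epsilon\in\mathbb{R}$ with $\tilde\epsilon<-1-\sum_{m=1}^M\epsilon_m$. For $x\in\mathbb{R}^M$, $\tilde x\in\mathbb{R}$ put $P(x,\tilde x)=\bigl(e^{\tilde x}-\sum_{m=1}^M e^{x_m}-1\bigr)^+$, and for $(u,\tilde u)\in\mathbb{R}^{M+1}+i(\epsilon,\tilde\epsilon)$ put $$\hat P(u,\tilde u)=\frac{\Gamma\bigl(i(\tilde u+\sum_{m=1}^M u_m)-1\bigr)\prod_{m=1}^M\Gamma(-iu_m)}{\Gamma(i\tilde u+1)},$$ where $\Gamma$ is the complex gamma function. Write $ux'=\sum_{m=1}^M u_mx_m$ (no conjugation). Then $\hat P$ is the Fourier transform of $P$ on $\mathbb{R}^{M+1}+i(\epsilon,\tilde\epsilon)$, that is $$\hat P(u,\tilde u)=\int_{\mathbb{R}^{M+1}}P(x,\tilde x)\,e^{-i\tilde u\tilde x-iux'}\,d^Mx\,d\tilde x$$ with an absolutely convergent integral, and $$P(x,\tilde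 x)=(2\pi)^{-(M+1)}\int_{\mathbb{R}^{M+1}+i(\epsilon,\tilde\epsilon)}e^{i\tilde u\tilde x+iux'}\,\hat P(u,\tilde u)\,d^Mu\,d\tilde u$$ in both of the following senses. (i) For every $x\in\mathbb{R}^M$ and $\tilde x\in\mathbb{R}$ the formula holds as an iterated integral, over $u\in\mathbb{R}^M+i\epsilon$ first and then over $\tilde u\in\mathbb{R}+i\tilde\epsilon$: the inner integral converges absolutely for every $\tilde u$, and its value is an absolutely integrable function of $\tilde u$. (ii) The formula holds in the $L^2$ sense of Fourier inversion: the functions $(x,\tilde x)\mapsto e^{\tilde\epsilon\tilde x+\epsilon x'}P(x,\tilde x)$ and $(a,b)\mapsto\hat P(a+i\epsilon,b+i\tilde\epsilon)$ belong to $L^2(\mathbb{R}^{M+1})$, and for every sequence of bounded measurable sets $K_n\subset\mathbb{R}^{M+1}$ such that almost every point of $\mathbb{R}^{M+1}$ lies in all but finitely many $K_n$, the integrals $$P_n(x,\tilde x)=(2\pi)^{-(M+1)}\int_{K_n+i(\epsilon,\tilde\epsilon)}e^{i\tilde u\tilde x+iux'}\,\hat P(u,\tilde u)\,d^Mu\,d\tilde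 u$$ converge absolutely and $e^{\tilde\epsilon\tilde x+\epsilon x'}\bigl(P_n(x,\tilde x)-P(x,\tilde x)\bigr)\to0$ in $L^2(\mathbb{R}^{M+1})$ as $n\to\infty$. -/

import Mathlib

noncomputable section

/-- The payoff `(e^{x̃} - ∑ₘ e^{xₘ} - 1)⁺` as a function of the log-prices `x = (x₁, …, x_M)`, `x̃`. -/
def basketPayoff {M : ℕ} (x : Fin M → ℝ) (xt : ℝ) : ℝ :=
  max (Real.exp xt - ∑ m, Real.exp (x m) - 1) 0

/-- `P̂(u, ũ) = Γ(i(ũ + ∑ₘ uₘ) - 1) ∏ₘ Γ(-i uₘ) / Γ(i ũ + 1)`. -/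
def payoffTransform {M : ℕ} (u : Fin M → ℂ) (ut : ℂ) : ℂ :=
  Complex.Gamma (Complex.I * (ut + ∑ m, u m) - 1) * (∏ m, Complex.Gamma (-Complex.I * u m))
    / Complex.Gamma (Complex.I * ut + 1)

/-- The complex bilinear pairing `ũ x̃ + u x'`. -/
def phase {M : ℕ} (u : Fin M → ℂ) (ut : ℂ) (x : Fin M → ℝ) (xt : ℝ) : ℂ :=
  ut * xt + ∑ m, u m * x m

/-- The point `a + i ε` of `ℝ^M + i ε`. -/
def shiftVec {M : ℕ} (ε a : Fin M → ℝ) : Fin M → ℂ := fun m => a m + Complex.I * ε m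

/-- The point `b + i ε̃` of `ℝ + i ε̃`. -/
def shiftPt (εt b : ℝ) : ℂ := b + Complex.I * εt

/-- The integrand `e^{i ũ x̃ + i u x'} P̂(u, ũ)` at the point `(u, ũ) = (a, b) + i (ε, ε̃)`. -/
def inversionIntegrand {M : ℕ} (ε : Fin M → ℝ) (εt : ℝ) (x : Fin M → ℝ) (xt : ℝ)
    (a : Fin M → ℝ) (b : ℝ) : ℂ :=
  Complex.exp (Complex.I * phase (shiftVec ε a) (shiftPt εt b) x xt)
    * payoffTransform (shiftVec ε a) (shiftPt εt b)

/-- The integral over the part of `ℝ^{M+1} + i (ε, ε̃)` whose real part lies in `K`,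
normalized by `(2π)^{-(M+1)}`. -/
def truncatedInversion {M : ℕ} (ε : Fin M → ℝ) (εt : ℝ) (K : Set ((Fin M → ℝ) × ℝ))
    (x : Fin M → ℝ) (xt : ℝ) : ℂ :=
  ((2 * Real.pi : ℂ) ^ (M + 1))⁻¹ * ∫ q in K, inversionIntegrand ε εt x xt q.1 q.2

/-- The damping factor `e^{ε̃ x̃ + ε x'}`. -/
def damping {M : ℕ} (ε : Fin M → ℝ) (εt : ℝ) (x : Fin M → ℝ) (xt : ℝ) : ℝ :=
  Real.exp (εt * xt + ∑ m, ε m * x m)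

end

open MeasureTheory Complex

/-! Put α_m = -iu_m, β = iũ and c(x) = 1 + ∑ e^{x_m}, so that P = (e^{x̃} - c(x))⁺ is a call payoff
with strike c(x). Integrating over x̃ first gives c^{1-β}/(β(β-1)) (`integral_call_payoff_mul_exp`).
The remaining integral over x is Dirichlet's with s = β - 1 (`integral_dirichlet_kernel`), and
Γ(β+1) = β(β-1)Γ(β-1) turns the result into P̂.

Pointwise inversion undoes these two steps separately. At fixed ũ, P̂ is integrable in u because
gamma functions decay quadratically on vertical lines, so Fourier inversion returns the call
transform with strike c(x) (`integral_inversionIntegrand_left`). That transform is O(|ũ|⁻²), and a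
one-dimensional inversion returns P (`integrable_and_integral_call_inversion`). Joint integrability
of P̂ is never needed.

For the L² statement, the imaginary shift amounts to multiplying P by the damping factor. The damped
payoff is integrable with values in [0, 1], hence in L¹ ∩ L², and Plancherel turns the truncation
error of P̂ into the error of the truncated inversion integral
(`tendsto_eLpNorm_fourierInv_indicator_sub`). -/

/-! ### The gamma function: Euler's integral in logarithmic coordinates and decay on vertical lines.
-/

theorem integrable_exp_mul_sub_exp_and_integral {s : ℂ} (hs : 0 < s.re) :
    Integrable (fun x : ℝ => cexp (s * x - Real.exp x)) ∧
      ∫ x : ℝ, cexp (s * x - Real.exp x) = Gamma s := by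
  have himg : Set.image Real.exp Set.univ = Set.Ioi 0 := by simp [Set.image_univ, Real.range_exp]
  have hder : ∀ x ∈ (Set.univ : Set ℝ), HasDerivWithinAt Real.exp (Real.exp x) Set.univ x :=
    fun x _ => (Real.hasDerivAt_exp x).hasDerivWithinAt
  have hinj : Set.InjOn Real.exp Set.univ := Real.exp_injective.injOn
  have hfun : ∀ x : ℝ, |Real.exp x| • ((Real.exp (-Real.exp x) : ℝ) * (Real.exp x : ℂ) ^ (s - 1))
      = cexp (s * x - Real.exp x) := by
    intro x
    rw [abs_of_pos (Real.exp_pos x), real_smul, cpow_def_of_ne_zero (by simp),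
      ← ofReal_log (Real.exp_pos x).le, Real.log_exp, ofReal_exp (-Real.exp x), ← Complex.exp_add]
    nth_rewrite 1 [ofReal_exp x]
    rw [← Complex.exp_add]
    congr 1
    push_cast
    ring
  have hint := GammaIntegral_convergent hs
  have hval := Gamma_eq_integral hs
  rw [GammaIntegral] at hval
  rw [← himg] at hint hval
  constructor
  · have h := (integrableOn_image_iff_integrableOn_abs_deriv_smul MeasurableSet.univ hder hinj
      _).1 hint
    simpa only [hfun, integrableOn_univ] using h
  · rw [hval, integral_image_eq_integral_abs_deriv_smul MeasurableSet.univ hder hinj]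
    simp only [hfun, setIntegral_univ]

theorem integrable_exp_mul_sub_exp {s : ℂ} (hs : 0 < s.re) :
    Integrable (fun x : ℝ => cexp (s * x - Real.exp x)) :=
  (integrable_exp_mul_sub_exp_and_integral hs).1

theorem integral_exp_mul_sub_exp {s : ℂ} (hs : 0 < s.re) :
    ∫ x : ℝ, cexp (s * x - Real.exp x) = Gamma s :=
  (integrable_exp_mul_sub_exp_and_integral hs).2

theorem norm_Gamma_le_Gamma_re {s : ℂ} (hs : 0 < s.re) : ‖Gamma s‖ ≤ Real.Gamma s.re := by
  have hr : 0 < ((s.re : ℝ) : ℂ).re := by simpa using hs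
  have hnorm : ∀ x : ℝ, ((‖cexp (s * x - Real.exp x)‖ : ℝ) : ℂ)
      = cexp ((s.re : ℝ) * x - Real.exp x) := by
    intro x
    rw [norm_exp, ofReal_exp]
    simp
  have h := integral_exp_mul_sub_exp hr
  simp only [← hnorm] at h
  rw [integral_complex_ofReal, Gamma_ofReal] at h
  rw [← integral_exp_mul_sub_exp hs, ← ofReal_injective h]
  exact norm_integral_le_integral_norm _

/-- Quadratic decay of the gamma function on vertical lines. -/
theorem norm_Gamma_le_div_sq {s : ℂ} (hs : 0 < s.re) :
    ‖Gamma s‖ ≤ Real.Gamma (s.re + 2) * (‖s‖ ^ 2)⁻¹ := by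
  have h0 : s ≠ 0 := fun h => by simp [h] at hs
  have h1 : s + 1 ≠ 0 := fun h => by
    have := congrArg Complex.re h
    simp at this
    linarith
  -- Two uses of the functional equation produce the two powers of ‖s‖, since ‖s + 1‖ ≥ ‖s‖ when Re
  -- s > 0.
  have hG : Gamma (s + 2) = (s + 1) * (s * Gamma s) := by
    rw [← Gamma_add_one s h0, ← Gamma_add_one (s + 1) h1]
    ring_nf
  have hle : ‖s‖ ≤ ‖s + 1‖ := by
    rw [Complex.norm_def, Complex.norm_def]
    apply Real.sqrt_le_sqrt
    simp only [normSq_apply, add_re, one_re, add_im, one_im]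
    nlinarith
  have hpos : 0 < ‖s‖ := norm_pos_iff.2 h0
  have hb : ‖Gamma (s + 2)‖ ≤ Real.Gamma (s.re + 2) := by
    simpa using norm_Gamma_le_Gamma_re (s := s + 2) (by simp; linarith)
  rw [← div_eq_mul_inv, le_div_iff₀ (by positivity)]
  refine le_trans ?_ hb
  rw [hG, norm_mul, norm_mul]
  nlinarith [norm_nonneg (Gamma s), mul_le_mul_of_nonneg_right hle
    (mul_nonneg hpos.le (norm_nonneg (Gamma s)))]

theorem integrable_inv_add_sq {σ : ℝ} (hσ : 0 < σ) :
    Integrable (fun t : ℝ => (σ ^ 2 + t ^ 2)⁻¹) := by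
  have h := (integrable_inv_one_add_sq.comp_div hσ.ne').const_mul ((σ ^ 2)⁻¹)
  refine h.congr (Filter.Eventually.of_forall fun t => ?_)
  simp only
  field_simp

theorem continuous_Gamma_comp {X : Type*} [TopologicalSpace X] {f : X → ℂ} (hf : Continuous f)
    (h : ∀ x, 0 < (f x).re) : Continuous fun x => Gamma (f x) := by
  refine continuous_iff_continuousAt.2 fun x => ?_
  refine ContinuousAt.comp (f := f) (g := Gamma) ?_ hf.continuousAt
  refine (differentiableAt_Gamma _ fun m hm => ?_).continuousAt
  have h1 := h x
  rw [hm] at h1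
  simp at h1
  linarith [(Nat.cast_nonneg m : (0 : ℝ) ≤ m)]

theorem integrable_Gamma_vertical {σ : ℝ} (hσ : 0 < σ) :
    Integrable (fun t : ℝ => Gamma (σ - I * t)) := by
  have hre : ∀ t : ℝ, ((σ : ℂ) - I * t).re = σ := fun t => by simp
  refine ((integrable_inv_add_sq hσ).const_mul (Real.Gamma (σ + 2))).mono'
    (continuous_Gamma_comp (by fun_prop) fun t => by rwa [hre]).aestronglyMeasurable
    (Filter.Eventually.of_forall fun t => ?_)
  have h := norm_Gamma_le_div_sq (s := (σ : ℂ) - I * t) (by rwa [hre])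
  rw [hre, ← normSq_eq_norm_sq, normSq_apply] at h
  simpa [pow_two] using h

theorem integral_prod_exp_mul_sub_exp {ι : Type*} [Fintype ι] (α : ι → ℂ)
    (hα : ∀ m, 0 < (α m).re) :
    ∫ x : ι → ℝ, ∏ m, cexp (α m * x m - Real.exp (x m)) = ∏ m, Gamma (α m) := by
  rw [integral_fintype_prod_volume_eq_prod (fun m (y : ℝ) => cexp (α m * y - Real.exp y))]
  exact Finset.prod_congr rfl fun m _ => integral_exp_mul_sub_exp (hα m)

theorem integrable_prod_exp_mul_sub_exp {ι : Type*} [Fintype ι] (α : ι → ℂ)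
    (hα : ∀ m, 0 < (α m).re) :
    Integrable fun x : ι → ℝ => ∏ m, cexp (α m * x m - Real.exp (x m)) :=
  Integrable.fintype_prod (f := fun m (y : ℝ) => cexp (α m * y - Real.exp y))
    fun m => integrable_exp_mul_sub_exp (hα m)

/-- A product kernel in sheared coordinates is integrable. -/
theorem integrable_mul_comp_add_const {ι : Type*} [Fintype ι] {G : (ι → ℝ) → ℂ} {g : ℝ → ℂ}
    (hG : Integrable G) (hg : Integrable g) (hGc : Continuous G) (hgc : Continuous g) :
    Integrable fun p : (ι → ℝ) × ℝ => g p.2 * G (p.1 + fun _ => p.2) := by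
  -- With the second coordinate fixed, the shear is a translation and preserves the L¹ norm of `G`.
  refine (integrable_prod_iff' (Continuous.aestronglyMeasurable (by fun_prop))).2 ⟨?_, ?_⟩
  · exact Filter.Eventually.of_forall fun T =>
      (hG.comp_add_right (fun _ => T)).const_mul (g T)
  · simp only [norm_mul, integral_const_mul]
    have : ∀ T : ℝ, ∫ x : ι → ℝ, ‖G (x + fun _ => T)‖ = ∫ x, ‖G x‖ := fun T =>
      integral_add_right_eq_self (fun x => ‖G x‖) (fun _ => T)
    simp only [this]
    exact hg.norm.mul_const _

/-! ### Dirichlet's integral. -/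

section Dirichlet

variable {ι : Type*} [Fintype ι]

theorem one_add_sum_exp_pos (x : ι → ℝ) : 0 < 1 + ∑ m, Real.exp (x m) := by
  have : 0 ≤ ∑ m, Real.exp (x m) := Finset.sum_nonneg fun m _ => (Real.exp_pos _).le
  linarith

theorem continuous_log_one_add_sum_exp :
    Continuous fun x : ι → ℝ => Real.log (1 + ∑ m, Real.exp (x m)) :=
  Continuous.log (by fun_prop) fun x => (one_add_sum_exp_pos x).ne'

/-- The double exponentials add up to e^T + ∑ e^{x_m+T} = e^{T + log c}, with c = 1 + ∑ e^{x_m}. A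
translation of T by log c then separates the power c^{-s} from a gamma integral. -/
theorem sheared_kernel_eq (s : ℂ) (α : ι → ℂ) (x : ι → ℝ) (T : ℝ) :
    cexp ((s - ∑ m, α m) * T - Real.exp T) *
        ∏ m, cexp (α m * (x m + T : ℝ) - Real.exp (x m + T))
      = cexp (-s * Real.log (1 + ∑ m, Real.exp (x m)) + ∑ m, α m * x m) *
        cexp (s * (T + Real.log (1 + ∑ m, Real.exp (x m)) : ℝ)
          - Real.exp (T + Real.log (1 + ∑ m, Real.exp (x m)))) := by
  rw [← Complex.exp_sum, ← Complex.exp_add, ← Complex.exp_add, Real.exp_add,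
    Real.exp_log (one_add_sum_exp_pos x)]
  congr 1
  simp only [Real.exp_add, Finset.sum_sub_distrib]
  push_cast
  simp only [mul_add, Finset.sum_add_distrib, ← Finset.sum_mul, sub_mul]
  ring

theorem integral_sheared_kernel {s : ℂ} (hs : 0 < s.re) (α : ι → ℂ) (x : ι → ℝ) :
    ∫ T : ℝ, cexp ((s - ∑ m, α m) * T - Real.exp T) *
        ∏ m, cexp (α m * (x m + T : ℝ) - Real.exp (x m + T))
      = cexp (-s * Real.log (1 + ∑ m, Real.exp (x m)) + ∑ m, α m * x m) * Gamma s := by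
  simp only [sheared_kernel_eq]
  rw [integral_const_mul, integral_add_right_eq_self
    (fun T : ℝ => cexp (s * (T : ℝ) - Real.exp T)), integral_exp_mul_sub_exp hs]

theorem integrable_sheared_kernel {s : ℂ} (α : ι → ℂ) (hα : ∀ m, 0 < (α m).re)
    (hs : 0 < (s - ∑ m, α m).re) :
    Integrable fun p : (ι → ℝ) × ℝ => cexp ((s - ∑ m, α m) * p.2 - Real.exp p.2) *
        ∏ m, cexp (α m * (p.1 m + p.2 : ℝ) - Real.exp (p.1 m + p.2)) :=
  integrable_mul_comp_add_const
    (G := fun x : ι → ℝ => ∏ m, cexp (α m * x m - Real.exp (x m)))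
    (integrable_prod_exp_mul_sub_exp α hα)
    (integrable_exp_mul_sub_exp hs) (by fun_prop) (by fun_prop)

theorem re_pos_of_sub_sum {s : ℂ} (α : ι → ℂ) (hα : ∀ m, 0 < (α m).re)
    (hs : 0 < (s - ∑ m, α m).re) : 0 < s.re := by
  rw [sub_re, re_sum] at hs
  have : 0 ≤ ∑ m, (α m).re := Finset.sum_nonneg fun m _ => (hα m).le
  linarith

/-- Dirichlet's multivariate beta integral in logarithmic coordinates. -/
theorem integral_dirichlet_kernel {s : ℂ} (α : ι → ℂ) (hα : ∀ m, 0 < (α m).re)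
    (hs : 0 < (s - ∑ m, α m).re) :
    ∫ x : ι → ℝ, cexp (-s * Real.log (1 + ∑ m, Real.exp (x m)) + ∑ m, α m * x m)
      = Gamma (s - ∑ m, α m) * (∏ m, Gamma (α m)) / Gamma s := by
  have hs0 := re_pos_of_sub_sum α hα hs
  have hint := integrable_sheared_kernel α hα hs
  -- After multiplication by Γ(s) the integrand is itself an integral over T. In the other order of
  -- integration, translating x by T decouples the variables.
  rw [eq_div_iff (Gamma_ne_zero_of_re_pos hs0), ← integral_mul_const]
  simp only [← integral_sheared_kernel hs0 α]
  rw [integral_integral_swap hint]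
  simp only [integral_const_mul]
  have h : ∀ T : ℝ, ∫ x : ι → ℝ,
      ∏ m, cexp (α m * (x m + T : ℝ) - Real.exp (x m + T))
      = ∏ m, Gamma (α m) := fun T => by
    rw [← integral_prod_exp_mul_sub_exp α hα]
    exact integral_add_right_eq_self
      (fun x : ι → ℝ => ∏ m, cexp (α m * (x m : ℝ) - Real.exp (x m))) (fun _ => T)
  simp only [h]
  rw [integral_mul_const, integral_exp_mul_sub_exp hs]

/-- Up to the nonzero constant Γ(s), this is the marginal of the integrable sheared kernel. -/
theorem integrable_dirichlet_kernel {s : ℂ} (α : ι → ℂ) (hα : ∀ m, 0 < (α m).re)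
    (hs : 0 < (s - ∑ m, α m).re) :
    Integrable fun x : ι → ℝ =>
      cexp (-s * Real.log (1 + ∑ m, Real.exp (x m)) + ∑ m, α m * x m) := by
  have hs0 := re_pos_of_sub_sum α hα hs
  have hint := (integrable_sheared_kernel α hα hs).integral_prod_left
  simp only [integral_sheared_kernel hs0] at hint
  refine (hint.mul_const (Gamma s)⁻¹).congr (Filter.Eventually.of_forall fun x => ?_)
  simp only
  rw [mul_assoc, mul_inv_cancel₀ (Gamma_ne_zero_of_re_pos hs0), mul_one]

end Dirichlet

/-! ### The transform of a one-dimensional call payoff. -/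

theorem call_payoff_mul_exp_eq_indicator {c : ℝ} (hc : 0 < c) (β : ℂ) (t : ℝ) :
    ((max (Real.exp t - c) 0 : ℝ) : ℂ) * cexp (-β * t)
      = (Set.Ioi (Real.log c)).indicator
        (fun t : ℝ => cexp ((1 - β) * t) - c * cexp (-β * t)) t := by
  by_cases h : Real.log c < t
  · have h' : c < Real.exp t := (Real.log_lt_iff_lt_exp hc).1 h
    rw [Set.indicator_of_mem (by exact h), max_eq_left (by linarith)]
    push_cast
    rw [sub_mul, ← Complex.exp_add]
    ring_nf
  · have h' : Real.exp t ≤ c := by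
      rw [← Real.exp_log hc]
      exact Real.exp_le_exp.2 (not_lt.1 h)
    rw [Set.indicator_of_notMem (by exact h), max_eq_right (by linarith)]
    simp

theorem integrable_call_payoff_mul_exp {c : ℝ} (hc : 0 < c) {β : ℂ} (hβ : 1 < β.re) :
    Integrable fun t : ℝ => ((max (Real.exp t - c) 0 : ℝ) : ℂ) * cexp (-β * t) := by
  simp only [call_payoff_mul_exp_eq_indicator hc]
  rw [show (fun t : ℝ => (Set.Ioi (Real.log c)).indicator
        (fun t : ℝ => cexp ((1 - β) * t) - c * cexp (-β * t)) t)
      = (Set.Ioi (Real.log c)).indicator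
        (fun t : ℝ => cexp ((1 - β) * t) - c * cexp (-β * t)) from rfl]
  rw [integrable_indicator_iff measurableSet_Ioi]
  exact (integrableOn_exp_mul_complex_Ioi (by simp; linarith) _).sub
    ((integrableOn_exp_mul_complex_Ioi (by simp; linarith) _).const_mul _)

theorem integral_call_payoff_mul_exp {c : ℝ} (hc : 0 < c) {β : ℂ} (hβ : 1 < β.re) :
    ∫ t : ℝ, ((max (Real.exp t - c) 0 : ℝ) : ℂ) * cexp (-β * t)
      = cexp ((1 - β) * Real.log c) / (β * (β - 1)) := by
  have h1 : β ≠ 0 := fun h => by simp [h] at hβ; linarith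
  have h2 : β - 1 ≠ 0 := fun h => by
    have := congrArg Complex.re h
    simp at this
    linarith
  have h3 : 1 - β ≠ 0 := fun h => h2 (by rw [← neg_sub, h, neg_zero])
  simp only [call_payoff_mul_exp_eq_indicator hc]
  rw [integral_indicator measurableSet_Ioi,
    integral_sub (integrableOn_exp_mul_complex_Ioi (by simp; linarith) _)
      ((integrableOn_exp_mul_complex_Ioi (by simp; linarith) _).const_mul _),
    integral_const_mul, integral_exp_mul_complex_Ioi (by simp; linarith),
    integral_exp_mul_complex_Ioi (by simp; linarith)]
  have h4 : (c : ℂ) * cexp (-β * Real.log c) = cexp ((1 - β) * Real.log c) := by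
    nth_rewrite 1 [← Real.exp_log hc]
    rw [ofReal_exp, ← Complex.exp_add]
    ring_nf
  rw [mul_div_assoc', mul_neg, h4]
  field_simp
  ring

/-! ### Fourier inversion in L². -/

section FourierLp

open FourierTransform Filter
open scoped ENNReal SchwartzMap RealInnerProductSpace

theorem AECover.tendsto_eLpNorm_indicator_sub {α E : Type*} [MeasurableSpace α]
    {μ : Measure α} [NormedAddCommGroup E] {g : α → E} (hg : MemLp g 2 μ) {K : ℕ → Set α}
    (hK : AECover μ atTop K) :
    Tendsto (fun n => eLpNorm ((K n).indicator g - g) 2 μ) atTop (nhds 0) := by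
  have h2 : (2 : ℝ≥0∞) ≠ 0 := two_ne_zero
  have h2' : (2 : ℝ≥0∞) ≠ ∞ := ENNReal.ofNat_ne_top
  simp only [eLpNorm_eq_lintegral_rpow_enorm_toReal h2 h2']
  have hlim : Tendsto (fun n => ∫⁻ x, ‖((K n).indicator g - g) x‖ₑ ^ (2 : ℝ≥0∞).toReal ∂μ)
      atTop (nhds (∫⁻ _, 0 ∂μ)) := by
    refine tendsto_lintegral_of_dominated_convergence'
      (fun x => ‖g x‖ₑ ^ (2 : ℝ≥0∞).toReal) ?_ ?_ ?_ ?_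
    · intro n
      exact (((hg.1.indicator (hK.measurableSet n)).sub hg.1).enorm).pow_const _
    · intro n
      refine Eventually.of_forall fun x => ?_
      by_cases hx : x ∈ K n <;> simp [hx]
    · exact ((eLpNorm_lt_top_iff_lintegral_rpow_enorm_lt_top h2 h2').1 hg.2).ne
    · filter_upwards [hK.ae_eventually_mem] with x hx
      refine tendsto_const_nhds.congr' ?_
      filter_upwards [hx] with n hn
      simp [hn]
  rw [lintegral_zero] at hlim
  have := hlim.ennrpow_const (1 / (2 : ℝ≥0∞).toReal)
  rwa [ENNReal.zero_rpow_of_pos (by norm_num)] at this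

theorem MeasureTheory.MemLp.integrableOn_of_isBounded {X E : Type*} [PseudoMetricSpace X]
    [ProperSpace X] [MeasurableSpace X] {μ : Measure X} [IsFiniteMeasureOnCompacts μ]
    [NormedAddCommGroup E] {g : X → E} (hg : MemLp g 2 μ) {K : Set X}
    (hK : Bornology.IsBounded K) : IntegrableOn g K μ := by
  have : IsFiniteMeasure (μ.restrict K) := ⟨by
    rw [Measure.restrict_apply_univ]
    exact hK.measure_lt_top⟩
  exact memLp_one_iff_integrable.1 ((hg.restrict K).mono_exponent one_le_two)

variable {V : Type*} [NormedAddCommGroup V] [InnerProductSpace ℝ V] [FiniteDimensional ℝ V]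
  [MeasurableSpace V] [BorelSpace V]

theorem continuous_fourier {f : V → ℂ} (hf : Integrable f) : Continuous (𝓕 f) :=
  VectorFourier.fourierIntegral_continuous Real.continuous_fourierChar
    (L := innerₗ V) continuous_inner hf

/-- Compactly supported smooth functions already separate locally integrable functions, and they are
Schwartz. -/
theorem ae_eq_of_integral_schwartz_smul_eq {f g : V → ℂ} (hf : LocallyIntegrable f)
    (hg : LocallyIntegrable g)
    (h : ∀ G : 𝓢(V, ℂ), ∫ x, G x • f x = ∫ x, G x • g x) : f =ᵐ[volume] g := by
  refine ae_eq_of_integral_contDiff_smul_eq hf hg fun φ φ_smooth φ_cpt => ?_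
  have hφ₁ : HasCompactSupport (ofRealCLM ∘ φ) := φ_cpt.comp_left rfl
  have hφ₂ : ContDiff ℝ (↑(⊤ : ℕ∞)) (ofRealCLM ∘ φ) := by fun_prop
  simpa using h (hφ₁.toSchwartzMap hφ₂)

/-- On `L¹ ∩ L²` the Fourier transform of `L²` is given by the Fourier integral. -/
theorem coeFn_fourier_toLp_ae_eq {f : V → ℂ} (h1 : Integrable f) (h2 : MemLp f 2) :
    (𝓕 (h2.toLp f) : Lp (α := V) ℂ 2) =ᵐ[volume] 𝓕 f := by
  refine ae_eq_of_integral_schwartz_smul_eq ((Lp.memLp _).locallyIntegrable one_le_two)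
    (continuous_fourier h1).locallyIntegrable fun G => ?_
  -- Against a Schwartz function, both transforms move onto the test function: the L² one by
  -- compatibility with tempered distributions, the integral one by the multiplication formula
  -- `hflip`.
  have key := congrArg (fun T => T G) (Lp.fourier_toTemperedDistribution_eq (h2.toLp f))
  simp only [TemperedDistribution.fourier_apply, Lp.toTemperedDistribution_apply] at key
  have hflip := VectorFourier.integral_fourierIntegral_smul_eq_flip (L := innerₗ V)
    Real.continuous_fourierChar continuous_inner (G.integrable (μ := volume)) h1
  rw [flip_innerₗ] at hflip
  rw [← key]
  refine Eq.trans (integral_congr_ae ?_) hflip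
  filter_upwards [h2.coeFn_toLp] with x hx
  rw [hx, SchwartzMap.fourier_coe]
  rfl

/-- On `L¹ ∩ L²` the inverse Fourier transform of `L²` is given by the Fourier integral. -/
theorem coeFn_fourierInv_toLp_ae_eq {f : V → ℂ} (h1 : Integrable f) (h2 : MemLp f 2) :
    (𝓕⁻ (h2.toLp f) : Lp (α := V) ℂ 2) =ᵐ[volume] 𝓕⁻ f := by
  have hL : Continuous fun p : V × V => (-innerₗ V) p.1 p.2 := continuous_inner.neg
  have hcont : Continuous (𝓕⁻ f) :=
    VectorFourier.fourierIntegral_continuous Real.continuous_fourierChar hL h1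
  refine ae_eq_of_integral_schwartz_smul_eq ((Lp.memLp _).locallyIntegrable one_le_two)
    hcont.locallyIntegrable fun G => ?_
  have key := congrArg (fun T => T G) (Lp.fourierInv_toTemperedDistribution_eq (h2.toLp f))
  simp only [TemperedDistribution.fourierInv_apply, Lp.toTemperedDistribution_apply] at key
  have hflip := VectorFourier.integral_fourierIntegral_smul_eq_flip (L := -innerₗ V)
    Real.continuous_fourierChar hL (G.integrable (μ := volume)) h1
  rw [show (-innerₗ V).flip = -innerₗ V by ext; simp [real_inner_comm]] at hflip
  rw [← key]
  refine Eq.trans (integral_congr_ae ?_) hflip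
  filter_upwards [h2.coeFn_toLp] with x hx
  rw [hx, SchwartzMap.fourierInv_coe]
  rfl

theorem memLp_two_fourier {f : V → ℂ} (h1 : Integrable f) (h2 : MemLp f 2) :
    MemLp (𝓕 f) 2 :=
  (memLp_congr_ae (coeFn_fourier_toLp_ae_eq h1 h2)).1 (Lp.memLp _)

/-- The isometry 𝓕 maps 𝓕⁻ A - B to A - 𝓕 B. -/
theorem eLpNorm_sub_fourier_Lp (A B : Lp ℂ 2 (volume : Measure V)) :
    eLpNorm (A - 𝓕 B : Lp ℂ 2 (volume : Measure V)) 2 volume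
      = eLpNorm (𝓕⁻ A - B : Lp ℂ 2 (volume : Measure V)) 2 volume := by
  have hiso : ‖A - 𝓕 B‖ = ‖𝓕⁻ A - B‖ := by
    rw [← Lp.norm_fourier_eq (𝓕⁻ A - B), sub_eq_add_neg (𝓕⁻ A), FourierTransform.fourier_add,
      FourierTransform.fourier_neg, fourier_fourierInv_eq A, sub_eq_add_neg]
  rwa [Lp.norm_def, Lp.norm_def, ENNReal.toReal_eq_toReal_iff' (Lp.eLpNorm_ne_top _)
    (Lp.eLpNorm_ne_top _)] at hiso

/-- Plancherel's identity on `L¹ ∩ L²`. -/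
theorem eLpNorm_sub_fourier {f g : V → ℂ} (hf1 : Integrable f) (hf2 : MemLp f 2)
    (hg1 : Integrable g) (hg2 : MemLp g 2) :
    eLpNorm (g - 𝓕 f) 2 = eLpNorm (𝓕⁻ g - f) 2 := by
  have hl : (g - 𝓕 f) =ᵐ[volume] (hg2.toLp g - 𝓕 (hf2.toLp f) : Lp (α := V) ℂ 2) :=
    (hg2.coeFn_toLp.symm.sub (coeFn_fourier_toLp_ae_eq hf1 hf2).symm).trans
      (Lp.coeFn_sub _ _).symm
  have hr : (𝓕⁻ g - f) =ᵐ[volume] (𝓕⁻ (hg2.toLp g) - hf2.toLp f : Lp (α := V) ℂ 2) :=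
    ((coeFn_fourierInv_toLp_ae_eq hg1 hg2).symm.sub hf2.coeFn_toLp.symm).trans
      (Lp.coeFn_sub _ _).symm
  rw [eLpNorm_congr_ae hl, eLpNorm_congr_ae hr, eLpNorm_sub_fourier_Lp]

/-- Fourier inversion in `L²` along truncations of the frequency domain. -/
theorem tendsto_eLpNorm_fourierInv_indicator_sub {f : V → ℂ} (h1 : Integrable f)
    (h2 : MemLp f 2) {K : ℕ → Set V} (hK : AECover volume atTop K)
    (hKb : ∀ n, Bornology.IsBounded (K n)) :
    Tendsto (fun n => eLpNorm (𝓕⁻ ((K n).indicator (𝓕 f)) - f) 2) atTop (nhds 0) := by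
  have hF := memLp_two_fourier h1 h2
  refine (AECover.tendsto_eLpNorm_indicator_sub hF hK).congr fun n => ?_
  -- Boundedness of `K n` puts the truncated transform in L¹, so its inverse transform is a genuine
  -- integral.
  exact eLpNorm_sub_fourier h1 h2
    ((hF.integrableOn_of_isBounded (hKb n)).integrable_indicator (hK.measurableSet n))
    (hF.indicator (hK.measurableSet n))

end FourierLp

/-! ### Angular frequency, on spaces identified with an inner product space. -/

section AngularFourier

open FourierTransform Filter
open scoped ENNReal RealInnerProductSpace

variable {V : Type*} [NormedAddCommGroup V] [InnerProductSpace ℝ V]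
  {X : Type*} [NormedAddCommGroup X] [NormedSpace ℝ X]

theorem exp_inner_eq (e : X ≃L[ℝ] V) (a x : X) :
    cexp (I * (⟪e a, e x⟫ : ℝ))
      = cexp (↑(2 * Real.pi * ⟪(2 * Real.pi)⁻¹ • e a, e x⟫) * I) := by
  rw [inner_smul_left]
  congr 1
  push_cast
  simp only [conj_trivial, ofReal_inv, ofReal_mul, ofReal_ofNat]
  field_simp

variable [FiniteDimensional ℝ V] [MeasurableSpace V] [BorelSpace V] [MeasureSpace X] [BorelSpace X]

/-- The Fourier integral in angular frequency, for the pairing transported along `e`. -/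
noncomputable def angularFourier (e : X ≃L[ℝ] V) (f : X → ℂ) (a : X) : ℂ :=
  ∫ x, cexp (-I * (⟪e a, e x⟫ : ℝ)) * f x

theorem integral_comp_continuousLinearEquiv {e : X ≃L[ℝ] V} (he : MeasurePreserving e)
    (F : V → ℂ) : ∫ x, F (e x) = ∫ v, F v :=
  he.integral_comp e.toHomeomorph.measurableEmbedding F

theorem measurePreserving_symm {e : X ≃L[ℝ] V} (he : MeasurePreserving e) :
    MeasurePreserving e.symm :=
  MeasurePreserving.symm e.toHomeomorph.toMeasurableEquiv he

theorem angularFourier_eq_fourier {e : X ≃L[ℝ] V} (he : MeasurePreserving e) (f : X → ℂ) (a : X) :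
    angularFourier e f a = 𝓕 (f ∘ e.symm) ((2 * Real.pi)⁻¹ • e a) := by
  rw [angularFourier, Real.fourier_eq', ← integral_comp_continuousLinearEquiv he]
  congr 1 with x
  simp only [Function.comp_apply, ContinuousLinearEquiv.symm_apply_apply, smul_eq_mul,
    inner_smul_right, real_inner_comm (e x)]
  congr 2
  push_cast
  field_simp

/-- The Jacobian of the rescaling by 2π is the normalizing constant of the inversion formula. -/
theorem integral_angular_eq {e : X ≃L[ℝ] V} (he : MeasurePreserving e) (F : V → ℂ) :
    ((2 * Real.pi : ℂ) ^ Module.finrank ℝ V)⁻¹ * ∫ a, F ((2 * Real.pi)⁻¹ • e a) = ∫ v, F v := by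
  rw [integral_comp_continuousLinearEquiv he (fun v => F ((2 * Real.pi)⁻¹ • v)),
    Measure.integral_comp_inv_smul_of_nonneg _ _ (by positivity), real_smul, ← mul_assoc]
  push_cast
  rw [inv_mul_cancel₀ (by simp [Real.pi_ne_zero]), one_mul]

theorem integrable_comp_inv_smul_iff {e : X ≃L[ℝ] V} (he : MeasurePreserving e) {F : V → ℂ} :
    Integrable (fun a => F ((2 * Real.pi)⁻¹ • e a)) ↔ Integrable F := by
  rw [← integrable_comp_smul_iff volume F (R := (2 * Real.pi)⁻¹) (by positivity)]
  exact he.integrable_comp_emb e.toHomeomorph.measurableEmbedding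
    (g := fun v => F ((2 * Real.pi)⁻¹ • v))

/-- Fourier inversion at every point for a continuous integrable function with integrable
transform. -/
theorem angularFourier_inversion {e : X ≃L[ℝ] V} (he : MeasurePreserving e) {f : X → ℂ}
    (hc : Continuous f) (hf : Integrable f) (hF : Integrable (angularFourier e f)) (x : X) :
    ((2 * Real.pi : ℂ) ^ Module.finrank ℝ V)⁻¹ *
      ∫ a, cexp (I * (⟪e a, e x⟫ : ℝ)) * angularFourier e f a = f x := by
  have hφ : Integrable (f ∘ e.symm) :=
    ((measurePreserving_symm he).integrable_comp_emb
      e.symm.toHomeomorph.measurableEmbedding).2 hf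
  rw [funext (angularFourier_eq_fourier he f), integrable_comp_inv_smul_iff he] at hF
  have hinv := congrFun ((hc.comp e.symm.continuous).fourierInv_fourier_eq hφ hF) (e x)
  rw [Real.fourierInv_eq'] at hinv
  simp only [angularFourier_eq_fourier he, exp_inner_eq]
  rw [integral_angular_eq he
    (fun v => cexp (↑(2 * Real.pi * ⟪v, e x⟫) * I) * 𝓕 (f ∘ e.symm) v)]
  simpa using hinv

theorem memLp_two_angularFourier {e : X ≃L[ℝ] V} (he : MeasurePreserving e) {f : X → ℂ}
    (h1 : Integrable f) (h2 : MemLp f 2) : MemLp (angularFourier e f) 2 := by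
  have hs := measurePreserving_symm he
  have hφ1 : Integrable (f ∘ e.symm) :=
    (hs.integrable_comp_emb e.symm.toHomeomorph.measurableEmbedding).2 h1
  have h := memLp_two_fourier hφ1 (h2.comp_measurePreserving hs)
  rw [funext (angularFourier_eq_fourier he f)]
  have hr : ((2 * Real.pi)⁻¹ : ℝ) ≠ 0 := by positivity
  have hsm : MemLp (fun v : V => 𝓕 (f ∘ e.symm) ((2 * Real.pi)⁻¹ • v)) 2 := by
    refine (memLp_map_measure_iff (f := fun v : V => (2 * Real.pi)⁻¹ • v)
      (g := 𝓕 (f ∘ e.symm)) ?_ (by fun_prop)).1 ?_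
    · exact (continuous_fourier hφ1).aestronglyMeasurable
    · rw [Measure.map_addHaar_smul volume hr]
      exact h.smul_measure ENNReal.ofReal_ne_top
  exact hsm.comp_measurePreserving he

/-- Fourier inversion in `L²` along truncations of the frequency domain. -/
theorem tendsto_eLpNorm_angularFourier_inversion {e : X ≃L[ℝ] V} (he : MeasurePreserving e)
    {f : X → ℂ} (h1 : Integrable f) (h2 : MemLp f 2) {K : ℕ → Set X}
    (hK : AECover volume atTop K) (hKb : ∀ n, Bornology.IsBounded (K n)) :
    Tendsto (fun n => eLpNorm (fun x => ((2 * Real.pi : ℂ) ^ Module.finrank ℝ V)⁻¹ *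
      (∫ a in K n, cexp (I * (⟪e a, e x⟫ : ℝ)) * angularFourier e f a) - f x) 2) atTop
      (nhds 0) := by
  have hs := measurePreserving_symm he
  have hφ1 : Integrable (f ∘ e.symm) :=
    (hs.integrable_comp_emb e.symm.toHomeomorph.measurableEmbedding).2 h1
  have hφ2 : MemLp (f ∘ e.symm) 2 := h2.comp_measurePreserving hs
  have hr : (2 * Real.pi : ℝ) ≠ 0 := by positivity
  -- `ψ` inverts a ↦ (2π)⁻¹ e(a), so `ψ ⁻¹' K n` is the truncation set in the frequency variable of
  -- 𝓕.
  let ψ : V → X := fun v => e.symm ((2 * Real.pi) • v)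
  have hψc : Continuous ψ := by fun_prop
  have hψe : ∀ a, ψ ((2 * Real.pi)⁻¹ • e a) = a := fun a => by
    simp only [ψ]
    rw [smul_inv_smul₀ hr, e.symm_apply_apply]
  have hψq : Measure.QuasiMeasurePreserving ψ := by
    refine hs.quasiMeasurePreserving.comp ⟨by fun_prop, ?_⟩
    rw [Measure.map_addHaar_smul volume hr]
    exact Measure.smul_absolutelyContinuous
  have hK' : AECover volume atTop fun n => ψ ⁻¹' K n :=
    ⟨hψq.ae hK.ae_eventually_mem, fun n => hψc.measurable (hK.measurableSet n)⟩
  have hKb' : ∀ n, Bornology.IsBounded (ψ ⁻¹' K n) := by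
    intro n
    let θ : X →L[ℝ] V := (2 * Real.pi)⁻¹ • (e : X →L[ℝ] V)
    refine (θ.lipschitz.isBounded_image (hKb n)).subset fun v hv => ⟨ψ v, hv, ?_⟩
    simp only [θ, ψ, _root_.smul_apply, ContinuousLinearEquiv.coe_coe,
      e.apply_symm_apply]
    exact inv_smul_smul₀ hr v
  refine (tendsto_eLpNorm_fourierInv_indicator_sub hφ1 hφ2 hK' hKb').congr fun n => ?_
  rw [← eLpNorm_comp_measurePreserving (f := e) ?_ he]
  · congr 1 with x
    have hint : ∫ a in K n, cexp (I * (⟪e a, e x⟫ : ℝ)) * angularFourier e f a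
        = ∫ a, (fun v => cexp (↑(2 * Real.pi * ⟪v, e x⟫) * I) *
          (ψ ⁻¹' K n).indicator (𝓕 (f ∘ e.symm)) v) ((2 * Real.pi)⁻¹ • e a) := by
      rw [← integral_indicator (hK.measurableSet n)]
      congr 1 with a
      simp only
      by_cases ha : a ∈ K n
      · rw [Set.indicator_of_mem ha, Set.indicator_of_mem (by rwa [Set.mem_preimage, hψe]),
          exp_inner_eq, angularFourier_eq_fourier he]
      · rw [Set.indicator_of_notMem ha, Set.indicator_of_notMem (by rwa [Set.mem_preimage, hψe]),
          mul_zero]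
    rw [hint, integral_angular_eq he (fun v => cexp (↑(2 * Real.pi * ⟪v, e x⟫) * I) *
          (ψ ⁻¹' K n).indicator (𝓕 (f ∘ e.symm)) v)]
    simp [Real.fourierInv_eq']
  · have hF := memLp_two_fourier hφ1 hφ2
    have hg : Integrable ((ψ ⁻¹' K n).indicator (𝓕 (f ∘ e.symm))) :=
      (hF.integrableOn_of_isBounded (hKb' n)).integrable_indicator (hK'.measurableSet n)
    have hcont : Continuous (𝓕⁻ ((ψ ⁻¹' K n).indicator (𝓕 (f ∘ e.symm)))) :=
      VectorFourier.fourierIntegral_continuous Real.continuous_fourierChar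
        (L := -innerₗ V) continuous_inner.neg hg
    exact hcont.aestronglyMeasurable.sub hφ2.1

end AngularFourier

/-! ### Measure-preserving identifications of the sup-normed coordinate spaces with Euclidean
spaces. -/

section Equivalences

theorem exists_measurePreserving_euclidean (M : ℕ) :
    ∃ e : (Fin M → ℝ) ≃L[ℝ] EuclideanSpace ℝ (Fin M), MeasurePreserving e ∧
      ∀ a x, inner ℝ (e a) (e x) = ∑ m, a m * x m := by
  refine ⟨(EuclideanSpace.equiv (Fin M) ℝ).symm, PiLp.volume_preserving_toLp (Fin M), fun a x => ?_⟩
  simp [PiLp.inner_apply, mul_comm]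

theorem exists_measurePreserving_euclidean_prod (M : ℕ) :
    ∃ e : ((Fin M → ℝ) × ℝ) ≃L[ℝ] WithLp 2 (EuclideanSpace ℝ (Fin M) × ℝ), MeasurePreserving e ∧
      ∀ a x, inner ℝ (e a) (e x) = a.2 * x.2 + ∑ m, a.1 m * x.1 m := by
  obtain ⟨e, he, hin⟩ := exists_measurePreserving_euclidean M
  refine ⟨(e.prodCongr (ContinuousLinearEquiv.refl ℝ ℝ)).trans
    (WithLp.prodContinuousLinearEquiv 2 ℝ (EuclideanSpace ℝ (Fin M)) ℝ).symm, ?_, fun a x => ?_⟩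
  · exact (WithLp.volume_preserving_toLp (EuclideanSpace ℝ (Fin M)) ℝ).comp
      (he.prod (MeasurePreserving.id volume))
  · simp [WithLp.prod_inner_apply, hin, mul_comm, add_comm]

end Equivalences

/-! ### The transform of the basket payoff. -/

section Payoff

variable {M : ℕ}

theorem basketPayoff_eq (x : Fin M → ℝ) (t : ℝ) :
    basketPayoff x t = max (Real.exp t - (1 + ∑ m, Real.exp (x m))) 0 := by
  rw [basketPayoff]
  congr 1
  ring

theorem continuous_basketPayoff :
    Continuous fun p : (Fin M → ℝ) × ℝ => basketPayoff p.1 p.2 := by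
  unfold basketPayoff
  fun_prop

theorem integral_norm_call_payoff_mul_exp {c : ℝ} (hc : 0 < c) {β : ℂ} (hβ : 1 < β.re) :
    ∫ t : ℝ, ‖((max (Real.exp t - c) 0 : ℝ) : ℂ) * cexp (-β * t)‖
      = Real.exp ((1 - β.re) * Real.log c) / (β.re * (β.re - 1)) := by
  have h := integral_call_payoff_mul_exp hc (β := (β.re : ℂ)) (by simpa using hβ)
  apply ofReal_injective
  rw [← integral_complex_ofReal]
  push_cast
  rw [← h]
  congr 1 with t
  rw [norm_mul, norm_exp, norm_real, Real.norm_of_nonneg (le_max_right _ _)]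
  push_cast
  simp

theorem one_lt_re_of_sub_sum {ι : Type*} [Fintype ι] {β : ℂ} (α : ι → ℂ)
    (hα : ∀ m, 0 < (α m).re) (hβ : 0 < (β - 1 - ∑ m, α m).re) : 1 < β.re := by
  have := re_pos_of_sub_sum α hα hβ
  simp at this
  linarith

theorem payoff_kernel_eq (α : Fin M → ℂ) (β : ℂ) (x : Fin M → ℝ) (t : ℝ) :
    (basketPayoff x t : ℂ) * cexp (-β * t + ∑ m, α m * x m)
      = cexp (∑ m, α m * x m) *
        (((max (Real.exp t - (1 + ∑ m, Real.exp (x m))) 0 : ℝ) : ℂ) * cexp (-β * t)) := by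
  rw [basketPayoff_eq, Complex.exp_add]
  ring

theorem integrable_basketPayoff_mul_exp (α : Fin M → ℂ) {β : ℂ} (hα : ∀ m, 0 < (α m).re)
    (hβ : 0 < (β - 1 - ∑ m, α m).re) :
    Integrable fun p : (Fin M → ℝ) × ℝ =>
      (basketPayoff p.1 p.2 : ℂ) * cexp (-β * p.2 + ∑ m, α m * p.1 m) := by
  have hβ1 := one_lt_re_of_sub_sum α hα hβ
  refine (integrable_prod_iff ?_).2 ⟨Filter.Eventually.of_forall fun x => ?_, ?_⟩
  · have := continuous_basketPayoff (M := M)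
    exact Continuous.aestronglyMeasurable (by fun_prop)
  · simp only [payoff_kernel_eq]
    exact (integrable_call_payoff_mul_exp (one_add_sum_exp_pos x) hβ1).const_mul _
  -- The inner integral of the norm is the modulus of the Dirichlet kernel with s = β - 1, divided
  -- by Re β (Re β - 1).
  · refine ((integrable_dirichlet_kernel α hα hβ).norm.mul_const
      ((β.re * (β.re - 1))⁻¹)).congr (Filter.Eventually.of_forall fun x => ?_)
    simp only [payoff_kernel_eq]
    simp_rw [norm_mul (cexp (∑ m, α m * (x m : ℂ)))]
    rw [integral_const_mul, integral_norm_call_payoff_mul_exp (one_add_sum_exp_pos x) hβ1,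
      Complex.exp_add, norm_mul, norm_exp (-(β - 1) * _), re_mul_ofReal]
    simp only [sub_re, one_re, neg_sub]
    ring

theorem Gamma_add_one_eq_mul_Gamma_sub_one {β : ℂ} (hβ : 1 < β.re) :
    Gamma (β + 1) = β * (β - 1) * Gamma (β - 1) := by
  have h1 : β ≠ 0 := fun h => by simp [h] at hβ; linarith
  have h2 : β - 1 ≠ 0 := fun h => by
    have := congrArg Complex.re h
    simp at this
    linarith
  rw [Gamma_add_one β h1]
  nth_rewrite 2 [show β = β - 1 + 1 by ring]
  rw [Gamma_add_one _ h2]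
  ring

theorem integral_basketPayoff_mul_exp (α : Fin M → ℂ) {β : ℂ} (hα : ∀ m, 0 < (α m).re)
    (hβ : 0 < (β - 1 - ∑ m, α m).re) :
    ∫ p : (Fin M → ℝ) × ℝ, (basketPayoff p.1 p.2 : ℂ) * cexp (-β * p.2 + ∑ m, α m * p.1 m)
      = Gamma (β - 1 - ∑ m, α m) * (∏ m, Gamma (α m)) / Gamma (β + 1) := by
  have hβ1 := one_lt_re_of_sub_sum α hα hβ
  rw [show (volume : Measure ((Fin M → ℝ) × ℝ)) = volume.prod volume from rfl,
    integral_prod _ (integrable_basketPayoff_mul_exp α hα hβ)]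
  simp only [payoff_kernel_eq, integral_const_mul]
  have h : ∀ x : Fin M → ℝ, cexp (∑ m, α m * x m) *
      ∫ t : ℝ, ((max (Real.exp t - (1 + ∑ m, Real.exp (x m))) 0 : ℝ) : ℂ) * cexp (-β * t)
      = cexp (-(β - 1) * Real.log (1 + ∑ m, Real.exp (x m)) + ∑ m, α m * x m)
        * (β * (β - 1))⁻¹ := fun x => by
    rw [integral_call_payoff_mul_exp (one_add_sum_exp_pos x) hβ1, Complex.exp_add, neg_sub]
    ring
  simp only [h]
  rw [integral_mul_const, integral_dirichlet_kernel α hα hβ,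
    Gamma_add_one_eq_mul_Gamma_sub_one hβ1]
  field_simp

end Payoff

/-! ### The substitution α = -iu, β = iũ on the shifted domain, and the damping factor. -/

section Shift

variable {M : ℕ} {ε : Fin M → ℝ} {εt : ℝ}

theorem re_neg_I_mul_shiftVec (a : Fin M → ℝ) (m : Fin M) :
    (-I * shiftVec ε a m).re = ε m := by
  simp [shiftVec]

theorem re_I_mul_shiftPt (b : ℝ) : (I * shiftPt εt b).re = -εt := by
  simp [shiftPt]

theorem re_I_mul_shiftPt_sub (a : Fin M → ℝ) (b : ℝ) :
    (I * shiftPt εt b - 1 - ∑ m, -I * shiftVec ε a m).re = -εt - 1 - ∑ m, ε m := by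
  simp only [sub_re, re_sum, re_neg_I_mul_shiftVec, re_I_mul_shiftPt, one_re]

theorem payoffTransform_eq (u : Fin M → ℂ) (ut : ℂ) :
    payoffTransform u ut = Gamma (I * ut - 1 - ∑ m, -I * u m) * (∏ m, Gamma (-I * u m))
      / Gamma (I * ut + 1) := by
  rw [payoffTransform]
  congr 3
  rw [← Finset.mul_sum]
  ring

theorem neg_I_mul_phase (u : Fin M → ℂ) (ut : ℂ) (x : Fin M → ℝ) (t : ℝ) :
    -I * phase u ut x t = -(I * ut) * t + ∑ m, -I * u m * x m := by
  rw [phase]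
  simp only [mul_assoc, ← Finset.mul_sum]
  ring

theorem neg_I_mul_phase_shift (x a : Fin M → ℝ) (t b : ℝ) :
    -I * phase (shiftVec ε a) (shiftPt εt b) x t
      = -I * ((b * t + ∑ m, a m * x m : ℝ) : ℂ) + ((εt * t + ∑ m, ε m * x m : ℝ) : ℂ) := by
  simp only [phase, shiftVec, shiftPt, add_mul, Finset.sum_add_distrib, mul_assoc,
    ← Finset.mul_sum]
  push_cast
  linear_combination (-(εt * t : ℂ) - ∑ m, (ε m * x m : ℂ)) * I_sq

theorem exp_neg_I_mul_phase_shift (x a : Fin M → ℝ) (t b : ℝ) :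
    cexp (-I * phase (shiftVec ε a) (shiftPt εt b) x t)
      = cexp (-I * ((b * t + ∑ m, a m * x m : ℝ) : ℂ)) * damping ε εt x t := by
  rw [neg_I_mul_phase_shift, Complex.exp_add, damping, ofReal_exp]

theorem damping_mul_inversionIntegrand (x a : Fin M → ℝ) (t b : ℝ) :
    (damping ε εt x t : ℂ) * inversionIntegrand ε εt x t a b
      = cexp (I * ((b * t + ∑ m, a m * x m : ℝ) : ℂ)) *
        payoffTransform (shiftVec ε a) (shiftPt εt b) := by
  have h := neg_I_mul_phase_shift (ε := ε) (εt := εt) x a t b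
  rw [inversionIntegrand, ← mul_assoc, damping, ofReal_exp, ← Complex.exp_add]
  congr 2
  linear_combination -h

theorem damping_ne_zero (x : Fin M → ℝ) (t : ℝ) : (damping ε εt x t : ℂ) ≠ 0 :=
  ofReal_ne_zero.2 (Real.exp_pos _).ne'

theorem inversionIntegrand_eq (x a : Fin M → ℝ) (t b : ℝ) :
    inversionIntegrand ε εt x t a b
      = (damping ε εt x t : ℂ)⁻¹ * (cexp (I * ((b * t + ∑ m, a m * x m : ℝ) : ℂ)) *
        payoffTransform (shiftVec ε a) (shiftPt εt b)) := by
  rw [← damping_mul_inversionIntegrand, inv_mul_cancel_left₀ (damping_ne_zero x t)]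

theorem integrable_payoff_phase (hε : ∀ m, 0 < ε m) (hεt : εt < -1 - ∑ m, ε m)
    (a : Fin M → ℝ) (b : ℝ) :
    Integrable fun p : (Fin M → ℝ) × ℝ => (basketPayoff p.1 p.2 : ℂ) *
      cexp (-I * phase (shiftVec ε a) (shiftPt εt b) p.1 p.2) := by
  simp only [neg_I_mul_phase]
  exact integrable_basketPayoff_mul_exp _ (fun m => by rw [re_neg_I_mul_shiftVec]; exact hε m)
    (by rw [re_I_mul_shiftPt_sub]; linarith)

theorem integral_payoff_phase (hε : ∀ m, 0 < ε m) (hεt : εt < -1 - ∑ m, ε m)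
    (a : Fin M → ℝ) (b : ℝ) :
    ∫ p : (Fin M → ℝ) × ℝ, (basketPayoff p.1 p.2 : ℂ) *
      cexp (-I * phase (shiftVec ε a) (shiftPt εt b) p.1 p.2)
      = payoffTransform (shiftVec ε a) (shiftPt εt b) := by
  simp only [neg_I_mul_phase]
  rw [payoffTransform_eq]
  exact integral_basketPayoff_mul_exp _ (fun m => by rw [re_neg_I_mul_shiftVec]; exact hε m)
    (by rw [re_I_mul_shiftPt_sub]; linarith)

end Shift

/-! ### The iterated inversion formula. -/

section Pointwise

variable {M : ℕ} {ε : Fin M → ℝ} {εt : ℝ}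

/-- The product of the Γ(-iu_m) is integrable factor by factor. The first gamma factor is bounded,
since its argument has constant positive real part, and the denominator does not depend on u. -/
theorem integrable_payoffTransform_left (hε : ∀ m, 0 < ε m) (hεt : εt < -1 - ∑ m, ε m) (b : ℝ) :
    Integrable fun a : Fin M → ℝ => payoffTransform (shiftVec ε a) (shiftPt εt b) := by
  have hprod : Integrable fun a : Fin M → ℝ => ∏ m, Gamma (-I * shiftVec ε a m) := by
    refine (Integrable.fintype_prod (f := fun m (t : ℝ) => Gamma (ε m - I * t))
      fun m => integrable_Gamma_vertical (hε m)).congr (Filter.Eventually.of_forall fun a => ?_)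
    refine Finset.prod_congr rfl fun m _ => ?_
    congr 1
    rw [shiftVec]
    linear_combination (ε m : ℂ) * I_sq
  have hpos : ∀ a : Fin M → ℝ, 0 < (I * shiftPt εt b - 1 - ∑ m, -I * shiftVec ε a m).re :=
    fun a => by rw [re_I_mul_shiftPt_sub]; linarith
  simp only [payoffTransform_eq]
  refine Integrable.div_const (hprod.bdd_mul
    (c := Real.Gamma (-εt - 1 - ∑ m, ε m))
    (continuous_Gamma_comp ?_ hpos).aestronglyMeasurable
    (Filter.Eventually.of_forall fun a => ?_)) _
  · unfold shiftVec
    fun_prop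
  · have := norm_Gamma_le_Gamma_re (hpos a)
    rwa [re_I_mul_shiftPt_sub] at this

theorem integrable_inversionIntegrand_left (hε : ∀ m, 0 < ε m) (hεt : εt < -1 - ∑ m, ε m)
    (x : Fin M → ℝ) (t b : ℝ) :
    Integrable fun a : Fin M → ℝ => inversionIntegrand ε εt x t a b := by
  simp only [inversionIntegrand_eq]
  refine Integrable.const_mul ((integrable_payoffTransform_left hε hεt b).bdd_mul (c := 1)
    (Continuous.aestronglyMeasurable (by fun_prop)) (Filter.Eventually.of_forall fun a => ?_)) _
  rw [mul_comm I, norm_exp_ofReal_mul_I]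

theorem one_lt_neg_of_lt (hε : ∀ m, 0 < ε m) (hεt : εt < -1 - ∑ m, ε m) : 1 < -εt := by
  have : 0 ≤ ∑ m, ε m := Finset.sum_nonneg fun m _ => (hε m).le
  linarith

/-- The integral over `u` of the inversion integrand. -/
theorem integral_inversionIntegrand_left (hε : ∀ m, 0 < ε m) (hεt : εt < -1 - ∑ m, ε m)
    (x : Fin M → ℝ) (t b : ℝ) :
    ∫ a : Fin M → ℝ, inversionIntegrand ε εt x t a b
      = (2 * Real.pi : ℂ) ^ M * (Real.exp (-(εt * t)) * (cexp (I * ((b * t : ℝ) : ℂ)) *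
        (cexp ((1 - I * shiftPt εt b) * Real.log (1 + ∑ m, Real.exp (x m)))
          / (I * shiftPt εt b * (I * shiftPt εt b - 1))))) := by
  obtain ⟨e, he, hin⟩ := exists_measurePreserving_euclidean M
  set β : ℂ := I * shiftPt εt b with hβdef
  have hβ : 1 < β.re := by
    rw [hβdef, re_I_mul_shiftPt]
    exact one_lt_neg_of_lt hε hεt
  -- `h` is the transform of P in x̃ alone, damped by e^{εx'}. By Dirichlet's integral its transform
  -- in x is P̂(·, ũ).
  set h : (Fin M → ℝ) → ℂ := fun x =>
    cexp (-(β - 1) * Real.log (1 + ∑ m, Real.exp (x m)) + ∑ m, (ε m : ℂ) * x m)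
      * (β * (β - 1))⁻¹ with hh
  have hcont : Continuous h := by
    have := continuous_log_one_add_sum_exp (ι := Fin M)
    fun_prop
  have hint : Integrable h := by
    refine (integrable_dirichlet_kernel (s := β - 1) (fun m => (ε m : ℂ))
      (fun m => by simpa using hε m) ?_).mul_const _
    rw [sub_re, sub_re, re_sum, hβdef, re_I_mul_shiftPt]
    simp only [ofReal_re, one_re]
    linarith
  have hF : angularFourier e h = fun a => payoffTransform (shiftVec ε a) (shiftPt εt b) := by
    funext a
    have hd := integral_dirichlet_kernel (s := β - 1) (fun m => -I * shiftVec ε a m)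
      (fun m => by rw [re_neg_I_mul_shiftVec]; exact hε m)
      (by rw [hβdef, re_I_mul_shiftPt_sub]; linarith)
    rw [payoffTransform_eq, ← hβdef, Gamma_add_one_eq_mul_Gamma_sub_one hβ, angularFourier]
    calc _ = ∫ x : Fin M → ℝ, cexp (-(β - 1) * Real.log (1 + ∑ m, Real.exp (x m))
          + ∑ m, -I * shiftVec ε a m * x m) * (β * (β - 1))⁻¹ := by
          congr 1 with y
          rw [hin, hh, ← mul_assoc, ← Complex.exp_add]
          congr 2
          simp only [shiftVec, mul_assoc, add_mul, ← Finset.mul_sum, Finset.sum_add_distrib]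
          push_cast
          linear_combination (∑ m, (ε m * y m : ℂ)) * I_sq
      _ = _ := by
          rw [integral_mul_const, hd]
          field_simp
  have hinv := angularFourier_inversion he hcont hint
    (by rw [hF]; exact integrable_payoffTransform_left hε hεt b) x
  rw [finrank_euclideanSpace_fin, hF, inv_mul_eq_iff_eq_mul₀ (by simp [Real.pi_ne_zero])] at hinv
  simp only [inversionIntegrand_eq]
  rw [integral_const_mul]
  have hsplit : ∀ a : Fin M → ℝ, cexp (I * ((b * t + ∑ m, a m * x m : ℝ) : ℂ)) *
      payoffTransform (shiftVec ε a) (shiftPt εt b)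
      = cexp (I * ((b * t : ℝ) : ℂ)) * (cexp (I * (inner ℝ (e a) (e x) : ℝ)) *
        payoffTransform (shiftVec ε a) (shiftPt εt b)) := fun a => by
    rw [hin, ofReal_add, mul_add, Complex.exp_add, mul_assoc]
  simp only [hsplit]
  rw [integral_const_mul, hinv, hh]
  simp only
  have hd : (damping ε εt x t : ℂ)⁻¹ * cexp (∑ m, (ε m : ℂ) * x m) = Real.exp (-(εt * t)) := by
    rw [damping, ofReal_exp, ← Complex.exp_neg, ← Complex.exp_add, ofReal_exp]
    congr 1
    push_cast
    ring
  rw [Complex.exp_add, neg_sub, ← hd, div_eq_mul_inv]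
  ring

theorem integrable_call_transform {εt : ℝ} (h : 1 < -εt) (c : ℝ) :
    Integrable fun b : ℝ => cexp ((1 - I * shiftPt εt b) * Real.log c)
      / (I * shiftPt εt b * (I * shiftPt εt b - 1)) := by
  have hc : Continuous fun b : ℝ => I * shiftPt εt b := by
    unfold shiftPt
    fun_prop
  have h1 : ∀ b : ℝ, I * shiftPt εt b ≠ 0 := fun b hb => by
    have := re_I_mul_shiftPt (εt := εt) b
    rw [hb] at this
    simp at this
    linarith
  have h2 : ∀ b : ℝ, I * shiftPt εt b - 1 ≠ 0 := fun b hb => by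
    have := re_I_mul_shiftPt (εt := εt) b
    rw [sub_eq_zero.1 hb] at this
    simp at this
    linarith
  -- Here σ = Re(β - 1), and |β| ≥ |β - 1| because Re β > 1, so the denominator is at least σ² + b².
  refine ((integrable_inv_add_sq (σ := -εt - 1) (by linarith)).const_mul
    (Real.exp ((1 + εt) * Real.log c))).mono' ?_ (Filter.Eventually.of_forall fun b => ?_)
  · exact (Continuous.div (by fun_prop) (by fun_prop)
      fun b => mul_ne_zero (h1 b) (h2 b)).aestronglyMeasurable
  · have hnum : ‖cexp ((1 - I * shiftPt εt b) * Real.log c)‖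
        = Real.exp ((1 + εt) * Real.log c) := by
      rw [norm_exp, re_mul_ofReal, sub_re, re_I_mul_shiftPt, one_re, sub_neg_eq_add]
    have hsq : ‖I * shiftPt εt b - 1‖ ^ 2 = (-εt - 1) ^ 2 + b ^ 2 := by
      rw [← normSq_eq_norm_sq, normSq_apply, sub_re, re_I_mul_shiftPt]
      simp [shiftPt]
      ring
    have hle : ‖I * shiftPt εt b - 1‖ ≤ ‖I * shiftPt εt b‖ := by
      rw [Complex.norm_def, Complex.norm_def]
      apply Real.sqrt_le_sqrt
      simp only [normSq_apply, sub_re, sub_im, re_I_mul_shiftPt, one_re, one_im, sub_zero]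
      nlinarith
    rw [norm_div, norm_mul, hnum, div_eq_mul_inv, ← hsq]
    have hpos := norm_pos_iff.2 (h2 b)
    gcongr
    nlinarith

theorem integrable_and_integral_call_inversion {εt : ℝ} (h : 1 < -εt) {c : ℝ} (hc : 0 < c)
    (t : ℝ) :
    Integrable (fun b : ℝ => cexp (I * ((b * t : ℝ) : ℂ)) *
      (cexp ((1 - I * shiftPt εt b) * Real.log c)
        / (I * shiftPt εt b * (I * shiftPt εt b - 1)))) ∧
    ∫ b : ℝ, cexp (I * ((b * t : ℝ) : ℂ)) *
      (cexp ((1 - I * shiftPt εt b) * Real.log c)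
        / (I * shiftPt εt b * (I * shiftPt εt b - 1)))
      = 2 * Real.pi * (Real.exp (εt * t) * (max (Real.exp t - c) 0 : ℝ)) := by
  have hT := integrable_call_transform h c
  constructor
  · refine hT.bdd_mul (c := 1) (Continuous.aestronglyMeasurable (by fun_prop))
      (Filter.Eventually.of_forall fun b => ?_)
    rw [mul_comm I, norm_exp_ofReal_mul_I]
  have hexp : ∀ b t : ℝ, cexp (-I * ((b * t : ℝ) : ℂ)) *
      (Real.exp (εt * t) * (max (Real.exp t - c) 0 : ℝ))
      = ((max (Real.exp t - c) 0 : ℝ) : ℂ) * cexp (-(I * shiftPt εt b) * t) := fun b t => by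
    rw [← mul_assoc, ofReal_exp (εt * t), ← Complex.exp_add, mul_comm]
    congr 2
    rw [shiftPt]
    push_cast
    linear_combination (εt * t : ℂ) * I_sq
  have hre : ∀ b : ℝ, 1 < (I * shiftPt εt b).re := fun b => by rwa [re_I_mul_shiftPt]
  let e := ContinuousLinearEquiv.refl ℝ ℝ
  have hin : ∀ a x : ℝ, inner ℝ (e a) (e x) = a * x := fun a x => by simp [e, mul_comm]
  set k : ℝ → ℂ := fun t => Real.exp (εt * t) * (max (Real.exp t - c) 0 : ℝ) with hk
  have hF : angularFourier e k = fun b => cexp ((1 - I * shiftPt εt b) * Real.log c)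
        / (I * shiftPt εt b * (I * shiftPt εt b - 1)) := by
    funext b
    rw [angularFourier, ← integral_call_payoff_mul_exp hc (hre b)]
    congr 1 with t
    rw [hin, hk, ← hexp b t]
  -- Continuity of the damped call payoff makes the inversion hold at every point, not merely almost
  -- everywhere.
  have hkc : Continuous k := by
    rw [hk]
    fun_prop
  have hki : Integrable k := by
    refine (integrable_call_payoff_mul_exp hc (hre 0)).congr
      (Filter.Eventually.of_forall fun t => ?_)
    simp only [← hexp 0 t, hk]
    simp
  have hinv := angularFourier_inversion (e := e) (MeasurePreserving.id volume) hkc hki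
    (by rw [hF]; exact hT) t
  rw [Module.finrank_self, hF, pow_one, inv_mul_eq_iff_eq_mul₀ (by simp [Real.pi_ne_zero])]
    at hinv
  rw [← hinv]
  simp only [hin]

end Pointwise

/-! ### The damped payoff in L¹ ∩ L². -/

section SquareIntegrable

variable {M : ℕ} {ε : Fin M → ℝ} {εt : ℝ}

theorem damping_mul_basketPayoff_nonneg (x : Fin M → ℝ) (t : ℝ) :
    0 ≤ damping ε εt x t * basketPayoff x t :=
  mul_nonneg (Real.exp_pos _).le (le_max_right _ _)

/-- Where the payoff is positive, t > 0 and every x_m ≤ t, so the product is at most exp((ε̃ + ∑ ε_m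
+ 1)t) ≤ 1. -/
theorem damping_mul_basketPayoff_le_one (hε : ∀ m, 0 < ε m) (hεt : εt < -1 - ∑ m, ε m)
    (x : Fin M → ℝ) (t : ℝ) : damping ε εt x t * basketPayoff x t ≤ 1 := by
  by_cases h : Real.exp t - ∑ m, Real.exp (x m) - 1 ≤ 0
  · rw [basketPayoff, max_eq_right h, mul_zero]
    exact zero_le_one
  · have hs : 0 ≤ ∑ m, Real.exp (x m) := Finset.sum_nonneg fun m _ => (Real.exp_pos _).le
    have ht : 0 < t := Real.one_lt_exp_iff.1 (by linarith)
    have hx : ∀ m, x m ≤ t := fun m => by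
      have := Finset.single_le_sum (f := fun m => Real.exp (x m))
        (fun m _ => (Real.exp_pos _).le) (Finset.mem_univ m)
      exact Real.exp_le_exp.1 (by linarith)
    have hsum : ∑ m, ε m * x m ≤ (∑ m, ε m) * t := by
      rw [Finset.sum_mul]
      exact Finset.sum_le_sum fun m _ => mul_le_mul_of_nonneg_left (hx m) (hε m).le
    rw [basketPayoff, max_eq_left (not_le.1 h).le, damping]
    calc _ ≤ Real.exp (εt * t + ∑ m, ε m * x m) * Real.exp t := by
          gcongr
          linarith
      _ ≤ 1 := by
          rw [← Real.exp_add, Real.exp_le_one_iff]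
          nlinarith

theorem integrable_damping_mul_basketPayoff (hε : ∀ m, 0 < ε m) (hεt : εt < -1 - ∑ m, ε m) :
    Integrable fun p : (Fin M → ℝ) × ℝ =>
      ((damping ε εt p.1 p.2 * basketPayoff p.1 p.2 : ℝ) : ℂ) := by
  refine (integrable_payoff_phase hε hεt 0 0).congr (Filter.Eventually.of_forall fun p => ?_)
  simp only [exp_neg_I_mul_phase_shift]
  simp [mul_comm]

theorem memLp_two_damping_mul_basketPayoff (hε : ∀ m, 0 < ε m) (hεt : εt < -1 - ∑ m, ε m) :
    MemLp (fun p : (Fin M → ℝ) × ℝ => damping ε εt p.1 p.2 * basketPayoff p.1 p.2) 2 := by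
  have hint : Integrable fun p : (Fin M → ℝ) × ℝ =>
      damping ε εt p.1 p.2 * basketPayoff p.1 p.2 := by
    simpa using (integrable_damping_mul_basketPayoff hε hεt).re
  -- Values in [0, 1] make the square at most the function itself, which is integrable.
  refine (memLp_two_iff_integrable_sq hint.1).2
    (hint.mono' (hint.1.pow 2) (Filter.Eventually.of_forall fun p => ?_))
  have h0 := damping_mul_basketPayoff_nonneg (ε := ε) (εt := εt) p.1 p.2
  rw [Real.norm_of_nonneg (by positivity)]
  nlinarith [damping_mul_basketPayoff_le_one hε hεt p.1 p.2]

theorem angularFourier_damping_mul_basketPayoff (hε : ∀ m, 0 < ε m)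
    (hεt : εt < -1 - ∑ m, ε m)
    (e : ((Fin M → ℝ) × ℝ) ≃L[ℝ] WithLp 2 (EuclideanSpace ℝ (Fin M) × ℝ))
    (hin : ∀ a x, inner ℝ (e a) (e x) = a.2 * x.2 + ∑ m, a.1 m * x.1 m) :
    angularFourier e (fun p => ((damping ε εt p.1 p.2 * basketPayoff p.1 p.2 : ℝ) : ℂ))
      = fun q => payoffTransform (shiftVec ε q.1) (shiftPt εt q.2) := by
  funext q
  rw [← integral_payoff_phase hε hεt, angularFourier]
  congr 1 with p
  rw [exp_neg_I_mul_phase_shift, hin]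
  push_cast
  ring

end SquareIntegrable

/-! ### Assembly of the three statements. -/

theorem proposition3 (M : ℕ) (hM : 2 ≤ M) (ε : Fin M → ℝ) (εt : ℝ)
    (hε : ∀ m, 0 < ε m) (hεt : εt < -1 - ∑ m, ε m) :
    -- `P̂` is the Fourier transform of the payoff on `ℝ^{M+1} + i (ε, ε̃)`
    (∀ (a : Fin M → ℝ) (b : ℝ),
      MeasureTheory.Integrable (fun p : (Fin M → ℝ) × ℝ =>
        (basketPayoff p.1 p.2 : ℂ) *
          Complex.exp (-Complex.I * phase (shiftVec ε a) (shiftPt εt b) p.1 p.2)) ∧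
      ∫ p : (Fin M → ℝ) × ℝ, (basketPayoff p.1 p.2 : ℂ) *
          Complex.exp (-Complex.I * phase (shiftVec ε a) (shiftPt εt b) p.1 p.2)
        = payoffTransform (shiftVec ε a) (shiftPt εt b)) ∧
    -- the inversion formula at every point, as an integral over `u` and then over `ũ`
    (∀ (x : Fin M → ℝ) (xt : ℝ),
      (∀ b : ℝ, MeasureTheory.Integrable (fun a : Fin M → ℝ =>
        inversionIntegrand ε εt x xt a b)) ∧
      MeasureTheory.Integrable (fun b : ℝ =>
        ∫ a : Fin M → ℝ, inversionIntegrand ε εt x xt a b) ∧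
      (basketPayoff x xt : ℂ) = ((2 * Real.pi : ℂ) ^ (M + 1))⁻¹ *
        ∫ b : ℝ, ∫ a : Fin M → ℝ, inversionIntegrand ε εt x xt a b) ∧
    -- the inversion formula with the integral over `ℝ^{M+1} + i (ε, ε̃)` in the `L²` sense
    (MeasureTheory.MemLp (fun p : (Fin M → ℝ) × ℝ =>
        damping ε εt p.1 p.2 * basketPayoff p.1 p.2) 2 ∧
      MeasureTheory.MemLp (fun q : (Fin M → ℝ) × ℝ =>
        payoffTransform (shiftVec ε q.1) (shiftPt εt q.2)) 2 ∧
      ∀ K : ℕ → Set ((Fin M → ℝ) × ℝ),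
        MeasureTheory.AECover MeasureTheory.volume Filter.atTop K →
        (∀ n, Bornology.IsBounded (K n)) →
        (∀ (n : ℕ) (x : Fin M → ℝ) (xt : ℝ), MeasureTheory.IntegrableOn
          (fun q : (Fin M → ℝ) × ℝ => inversionIntegrand ε εt x xt q.1 q.2) (K n)) ∧
        Filter.Tendsto (fun n => MeasureTheory.eLpNorm (fun p : (Fin M → ℝ) × ℝ =>
            (damping ε εt p.1 p.2 : ℂ) *
              (truncatedInversion ε εt (K n) p.1 p.2 - (basketPayoff p.1 p.2 : ℂ)))
            2 MeasureTheory.volume)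
          Filter.atTop (nhds 0)) := by
  obtain ⟨e, he, hin⟩ := exists_measurePreserving_euclidean_prod M
  have h1 := integrable_damping_mul_basketPayoff hε hεt
  have h2 := memLp_two_damping_mul_basketPayoff hε hεt
  have hF := angularFourier_damping_mul_basketPayoff hε hεt e hin
  have hL2 : MemLp (fun q : (Fin M → ℝ) × ℝ =>
      payoffTransform (shiftVec ε q.1) (shiftPt εt q.2)) 2 := by
    rw [← hF]
    exact memLp_two_angularFourier he h1 h2.ofReal
  refine ⟨fun a b => ⟨integrable_payoff_phase hε hεt a b, integral_payoff_phase hε hεt a b⟩,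
    fun x t => ⟨fun b => integrable_inversionIntegrand_left hε hεt x t b, ?_, ?_⟩,
    h2, hL2, fun K hK hKb => ⟨fun n x t => ?_, ?_⟩⟩
  · simp only [integral_inversionIntegrand_left hε hεt]
    exact ((integrable_and_integral_call_inversion (one_lt_neg_of_lt hε hεt)
      (one_add_sum_exp_pos x) t).1.const_mul _).const_mul _
  · simp only [integral_inversionIntegrand_left hε hεt]
    rw [integral_const_mul, integral_const_mul, (integrable_and_integral_call_inversion
      (one_lt_neg_of_lt hε hεt) (one_add_sum_exp_pos x) t).2, ← basketPayoff_eq]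
    have hexp : (Real.exp (-(εt * t)) : ℂ) * Real.exp (εt * t) = 1 := by
      rw [← ofReal_mul, ← Real.exp_add]
      simp
    have hpi : (Real.pi : ℂ) ≠ 0 := ofReal_ne_zero.2 Real.pi_ne_zero
    rw [eq_inv_mul_iff_mul_eq₀ (by simp [hpi]), pow_succ]
    linear_combination -(2 * Real.pi : ℂ) ^ M * (2 * Real.pi) * basketPayoff x t * hexp
  · simp only [inversionIntegrand_eq]
    refine Integrable.const_mul ((hL2.integrableOn_of_isBounded (hKb n)).bdd_mul (c := 1)
      (Continuous.aestronglyMeasurable (by fun_prop)) (Filter.Eventually.of_forall fun q => ?_)) _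
    rw [mul_comm I, norm_exp_ofReal_mul_I]
  · refine (tendsto_eLpNorm_angularFourier_inversion he h1 h2.ofReal hK hKb).congr fun n => ?_
    have hrank : Module.finrank ℝ (WithLp 2 (EuclideanSpace ℝ (Fin M) × ℝ)) = M + 1 := by
      rw [← e.toLinearEquiv.finrank_eq]
      simp
    rw [hF, hrank]
    congr 1 with p
    -- Moved under the integral sign, the damping cancels the real exponential in the integrand and
    -- leaves the angular Fourier kernel.
    rw [truncatedInversion, mul_sub, mul_left_comm,
      ← integral_const_mul (damping ε εt p.1 p.2 : ℂ)]
    simp only [damping_mul_inversionIntegrand, hin]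
    push_cast
    rfl
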